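/- Let $(L^{(1)}_t)_{t\ge 0}$ be a real-valued, centered Lévy process on a probability space $(\Omega,\mathcal A,P)$, without Gaussian component, whose Lévy measure $\phi$ satisfies $\int_{\{|x|>1\}}x^2\,\phi(dx)<\infty$. Let $L^{(2)}$ be an independent copy of $L^{(1)}$ and let $L=(L_t)_{t\in\mathbb R}$ be the two-sided Lévy process with $L_t=L^{(1)}_t$ for $t\ge 0$ and $L_t=-L^{(2)}_{(-t)-}$ for $t<0$. Let $f:\mathbb R^2\to\mathbb R$ be Borel measurable with $f(t,\cdot)\in L^2(\mathbb R)$ for every $t\in\mathbb R$, and let $$X_t=\int_{\mathbb R}f(t,u)\,L(du),\qquad t\in\mathbb R,$$ where the integral is the $L^2(P)$-limit of the elementary integrals $\sum_i a_i\,(L_{s_{i+1}}-L_{s_i})$ of step functions $\sum_i a_i 1_{(s_i,s_{i+1}]}$ that converge to $f(t,\cdot)$ in $L^2(\mathbb R)$. Let $\alpha,\delta\in\mathbb R$ and suppose that for some $c>1$ $$f(ct,c^{\delta}u)=c^{\alpha-\frac{\delta}{2}}f(t,u)\qquad\text{for all }t,u\in\mathbb R .$$ Then the generalized fractional Lévy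 process $X=(X_t)_{t\in\mathbb R}$ is $(c,\alpha,\delta)$-dilatively semistable. That is, all finite-dimensional marginal distributions of $X$ are infinitely divisible, and for every $m\in\mathbb Z$, with $b=c^m$, $$\psi_{bt_1,\ldots,bt_k}(\theta_1,\ldots,\theta_k)=b^{\delta}\,\psi_{t_1,\ldots,t_k}\big(b^{\alpha-\frac{\delta}{2}}\theta_1,\ldots,b^{\alpha-\frac{\delta}{2}}\theta_k\big)$$ for all $k\in\mathbb N$ and all $\theta_1,\ldots,\theta_k,t_1,\ldots,t_k\in\mathbb R$, where $\psi_{t_1,\ldots,t_k}$ denotes the log-characteristic function of $(X_{t_1},\ldots,X_{t_k})$, i.e. the unique continuous function with $\psi_{t_1,\ldots,t_k}(0,\ldots,0)=0$ and $E\big[\exp\big(i\sum_{j=1}^k\theta_jX_{t_j}\big)\big]=\exp\big(\psi_{t_1,\ldots,t_k}(\theta_1,\ldots,\theta_k)\big)$. -/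

import Mathlib

open MeasureTheory ProbabilityTheory Filter Topology
open scoped NNReal ENNReal

noncomputable section

namespace DilSemi

variable {Ω : Type*} [MeasurableSpace Ω]

/-! ### Lévy processes -/

/-- A real-valued Lévy process `(L_t)_{t ≥ 0}` under `P`. -/
structure IsLevyProcess (P : Measure Ω) (L : ℝ≥0 → Ω → ℝ) : Prop where
  measurable : ∀ t, Measurable (L t)
  zero : ∀ᵐ ω ∂P, L 0 ω = 0
  indep_increments : HasIndepIncrements L P
  stationary_increments : ∀ s h : ℝ≥0,
    IdentDistrib (fun ω => L (s + h) ω - L s ω) (L h) P P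
  stochastically_continuous : ∀ t : ℝ≥0, TendstoInMeasure P L (𝓝 t) (L t)
  cadlag : ∀ᵐ ω ∂P, ∀ t : ℝ≥0,
    ContinuousWithinAt (fun s => L s ω) (Set.Ici t) t ∧
      ∃ l : ℝ, Tendsto (fun s => L s ω) (𝓝[<] t) (𝓝 l)

/-- A Lévy measure on `ℝ`: no mass at `0`, and `∫ min(1, x²) φ(dx) < ∞`. -/
structure IsLevyMeasure (φ : Measure ℝ) : Prop where
  zero : φ {0} = 0
  integrable : Integrable (fun x : ℝ => min 1 (x ^ 2)) φ

/-- The Lévy-Khintchine exponent of the triplet `(γ, v, φ)` (drift, Gaussian variance, Lévy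
measure), with truncation function `x 1_{|x| ≤ 1}`. -/
def levyExponent (γ : ℝ) (v : ℝ≥0) (φ : Measure ℝ) (θ : ℝ) : ℂ :=
  Complex.I * γ * θ - (v : ℂ) * (θ : ℂ) ^ 2 / 2 +
    ∫ x : ℝ, (Complex.exp (Complex.I * θ * x) - 1 -
      (if |x| ≤ 1 then Complex.I * θ * x else 0)) ∂φ

/-- `(γ, v, φ)` is the generating triplet of the process `L`: `φ` is a Lévy measure and
`E exp(i θ L_t)` is `exp(t ψ(θ))` for the Lévy-Khintchine exponent `ψ` of the triplet. The process
has no Gaussian component when `v = 0`. -/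
structure HasLevyTriplet (P : Measure Ω) (L : ℝ≥0 → Ω → ℝ)
    (γ : ℝ) (v : ℝ≥0) (φ : Measure ℝ) : Prop where
  isLevyMeasure : IsLevyMeasure φ
  charFun_eq : ∀ (t : ℝ≥0) (θ : ℝ),
    ∫ ω, Complex.exp (Complex.I * θ * L t ω) ∂P = Complex.exp ((t : ℂ) * levyExponent γ v φ θ)

/-- All one-dimensional marginals are integrable with mean zero. -/
def IsCentered (P : Measure Ω) (L : ℝ≥0 → Ω → ℝ) : Prop :=
  ∀ t, Integrable (L t) P ∧ ∫ ω, L t ω ∂P = 0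

/-- `L₂` is an independent copy of the process `L₁` (equality in law and independence are those of
the processes as random elements of `ℝ^{[0,∞)}` with the product `σ`-algebra). -/
structure IsIndepCopy (P : Measure Ω) (L₁ L₂ : ℝ≥0 → Ω → ℝ) : Prop where
  identDistrib : IdentDistrib (fun ω t => L₁ t ω) (fun ω t => L₂ t ω) P P
  indep : IndepFun (fun ω t => L₁ t ω) (fun ω t => L₂ t ω) P

/-- The two-sided process `L_t = L₁(t)` for `t ≥ 0` and `L_t = - L₂((-t)-)` for `t < 0`. -/
def twoSided (L₁ L₂ : ℝ≥0 → Ω → ℝ) (t : ℝ) (ω : Ω) : ℝ :=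
  if 0 ≤ t then L₁ t.toNNReal ω
  else - Function.leftLim (fun s : ℝ≥0 => L₂ s ω) (-t).toNNReal

/-! ### Integration with respect to a two-sided process -/

/-- The data of a step function `∑ i, a_i 1_{(s_i, s_{i+1}]}` on `ℝ`, with `s_0 ≤ ⋯ ≤ s_n`. -/
structure StepFunction where
  n : ℕ
  node : Fin (n + 1) → ℝ
  mono : Monotone node
  coef : Fin n → ℝ

/-- The step function as a function on `ℝ`. -/
def StepFunction.eval (g : StepFunction) (u : ℝ) : ℝ :=
  ∑ i : Fin g.n, (Set.Ioc (g.node i.castSucc) (g.node i.succ)).indicator (fun _ => g.coef i) u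

/-- The elementary integral `∫ g dL = ∑ i, a_i (L(s_{i+1}) - L(s_i))`. -/
def StepFunction.integral (g : StepFunction) (L : ℝ → Ω → ℝ) (ω : Ω) : ℝ :=
  ∑ i : Fin g.n, g.coef i * (L (g.node i.succ) ω - L (g.node i.castSucc) ω)

/-- `Y` is (a version of) the integral `∫ g(u) L(du)`: the limit in `L²(P)` of the elementary
integrals of step functions that converge to `g` in `L²(ℝ)`. -/
def IsLevyIntegral (P : Measure Ω) (L : ℝ → Ω → ℝ) (g : ℝ → ℝ) (Y : Ω → ℝ) : Prop :=
  MemLp Y 2 P ∧ ∃ G : ℕ → StepFunction,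
    Tendsto (fun m => eLpNorm (fun u => (G m).eval u - g u) 2 volume) atTop (𝓝 0) ∧
    Tendsto (fun m => eLpNorm (fun ω => (G m).integral L ω - Y ω) 2 P) atTop (𝓝 0)

/-- `X_t = ∫ f(t, u) L(du)`, `t ∈ ℝ`, for a Borel kernel `f` with `f(t, ·) ∈ L²(ℝ)` for all `t`. -/
structure IsGeneralizedFractionalLevy (P : Measure Ω) (L : ℝ → Ω → ℝ) (f : ℝ → ℝ → ℝ)
    (X : ℝ → Ω → ℝ) : Prop where
  measurable_kernel : Measurable (fun p : ℝ × ℝ => f p.1 p.2)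
  memLp_kernel : ∀ t, MemLp (f t) 2 volume
  isLevyIntegral : ∀ t, IsLevyIntegral P L (f t) (X t)

/-! ### Dilative semistability -/

/-- A law on `ℝ^k` is infinitely divisible if for every `n ≥ 1` it is the law of the sum of `n`
i.i.d. random vectors. -/
def IsInfinitelyDivisible {k : ℕ} (μ : Measure (Fin k → ℝ)) : Prop :=
  ∀ n : ℕ, 0 < n → ∃ ν : Measure (Fin k → ℝ), IsProbabilityMeasure ν ∧
    μ = (Measure.pi (fun _ : Fin n => ν)).map (fun x => ∑ i, x i)

/-- `ψ` is the log-characteristic function of the random vector `(Y_1, …, Y_k)`: the (unique)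
continuous function with `ψ 0 = 0` and `E exp(i ∑ θ_j Y_j) = exp(ψ(θ))`. -/
structure IsLogCharFun (P : Measure Ω) {k : ℕ} (Y : Fin k → Ω → ℝ) (ψ : (Fin k → ℝ) → ℂ) :
    Prop where
  continuous : Continuous ψ
  zero : ψ 0 = 0
  charFun_eq : ∀ θ : Fin k → ℝ,
    ∫ ω, Complex.exp (Complex.I * ((∑ j, θ j * Y j ω : ℝ) : ℂ)) ∂P = Complex.exp (ψ θ)

/-- The dilative decomposability group `D_X(α, δ)`: all `c > 0` such that
`ψ_{c t}(θ) = c^δ ψ_t(c^{α - δ/2} θ)` for all `k`, `θ ∈ ℝ^k` and `t ∈ ℝ^k`, where `ψ` and `ψ'` are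
the log-characteristic functions of `X` at the times `t` and `c t`. -/
def dilativeDecompGroup (P : Measure Ω) (X : ℝ → Ω → ℝ) (α δ : ℝ) : Set ℝ :=
  {c | 0 < c ∧ ∀ (k : ℕ) (t : Fin k → ℝ), ∃ ψ ψ' : (Fin k → ℝ) → ℂ,
    IsLogCharFun P (fun j => X (t j)) ψ ∧ IsLogCharFun P (fun j => X (c * t j)) ψ' ∧
    ∀ θ : Fin k → ℝ, ψ' θ = ((c ^ δ : ℝ) : ℂ) * ψ (fun j => c ^ (α - δ / 2) * θ j)}

/-- `(X_t)_{t ∈ ℝ}` is `(c, α, δ)`-dilatively semistable. -/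
structure IsDilativelySemistable (P : Measure Ω) (X : ℝ → Ω → ℝ) (c α δ : ℝ) : Prop where
  one_lt : 1 < c
  infinitelyDivisible : ∀ (k : ℕ) (t : Fin k → ℝ),
    IsInfinitelyDivisible (P.map (fun ω (j : Fin k) => X (t j) ω))
  zpow_mem : ∀ m : ℤ, c ^ m ∈ dilativeDecompGroup P X α δ

end DilSemi

end

/-!
Since `L₁` is centered with finite second moment of the Lévy measure, its exponent is
`ψ(θ) = ∫ (exp(iθx) - 1 - iθx) φ(dx)`
(`HasLevyTriplet.levyExponent_eq_compExponent`), and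
`|ψ(a) - ψ(b)| ≤ ∫ x² φ(dx) · |a - b| (|a| + |b|)` (`norm_compExponent_sub_le`). By Cauchy-Schwarz,
this makes `g ↦ ∫ ψ(g(u)) du` a continuous functional on `L²(ℝ)`
(`tendsto_integral_comp_of_tendsto_eLpNorm`).

For step functions `G_j`, independence and stationarity of the increments give
`E exp(i ∑ θ_j ∫ G_j dL) = exp(∫ ψ(∑ θ_j G_j(u)) du)` (`charFun_stepFunction_integral`). Both sides
pass to the `L²` limit, so `θ ↦ ∫ ψ(∑ θ_j f(t_j, u)) du` is the log-characteristic function of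
`(X_{t_1}, …, X_{t_k})` (`isLogCharFun_of_isLevyIntegral`). The scaling relation for it is the
substitution `u = b^δ v` combined with the scaling relation of the kernel.

For infinite divisibility, the substitution `u ↦ n u` shows that the step functions `G_j(n ·)` have
integrals with exponent `n⁻¹ ∫ ψ(∑ θ_j G_j(u)) du`. By Lévy's continuity theorem their laws have a
limit law along the approximation, which is the required `n`-th convolution root
(`isInfinitelyDivisible_of_isLevyIntegral`).
-/

noncomputable section

namespace DilSemi

/-! ### The exponent of a centered Lévy process -/

/-- The exponent `∫ (exp(iθx) - 1 - iθx) φ(dx)` of a centered Lévy process without Gaussian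
component, in which every jump is compensated. -/
def compExponent (φ : Measure ℝ) (θ : ℝ) : ℂ :=
  ∫ x : ℝ, (Complex.exp (Complex.I * θ * x) - 1 - Complex.I * θ * x) ∂φ

/-- The derivative `i (exp(is) - 1)` of `s ↦ exp(is) - 1 - is` has norm at most `|s|`. -/
lemma norm_exp_sub_one_sub_sub_le (a b : ℝ) :
    ‖(Complex.exp (Complex.I * a) - 1 - Complex.I * a) -
      (Complex.exp (Complex.I * b) - 1 - Complex.I * b)‖ ≤ |a - b| * (|a| + |b|) := by
  have hder : ∀ s ∈ Set.uIcc b a, HasDerivWithinAt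
      (fun s : ℝ => Complex.exp (Complex.I * s) - 1 - Complex.I * s)
      (Complex.exp (Complex.I * s) * Complex.I - Complex.I) (Set.uIcc b a) s := by
    intro s _
    have h1 : HasDerivAt (fun s : ℝ => Complex.I * (s : ℂ)) (Complex.I * 1) s :=
      (Complex.ofRealCLM.hasDerivAt (x := s)).const_mul Complex.I
    have h2 := (h1.cexp.sub_const 1).sub h1
    simp only [mul_one] at h2
    exact h2.hasDerivWithinAt
  have hbd : ∀ s ∈ Set.uIcc b a,
      ‖Complex.exp (Complex.I * s) * Complex.I - Complex.I‖ ≤ |a| + |b| := by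
    intro s hs
    have : Complex.exp (Complex.I * s) * Complex.I - Complex.I
        = (Complex.exp (Complex.I * s) - 1) * Complex.I := by ring
    rw [this, norm_mul, Complex.norm_I, mul_one]
    refine (Real.norm_exp_I_mul_ofReal_sub_one_le).trans ?_
    rw [Real.norm_eq_abs]
    rcases Set.mem_uIcc.1 hs with h | h
    · refine (abs_le_max_abs_abs h.1 h.2).trans (max_le ?_ ?_) <;>
        linarith [abs_nonneg a, abs_nonneg b]
    · refine (abs_le_max_abs_abs h.1 h.2).trans (max_le ?_ ?_) <;>
        linarith [abs_nonneg a, abs_nonneg b]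
  have := (convex_uIcc b a).norm_image_sub_le_of_norm_hasDerivWithin_le hder hbd
    Set.left_mem_uIcc Set.right_mem_uIcc
  rw [Real.norm_eq_abs] at this
  linarith

lemma norm_exp_sub_one_sub_le (a : ℝ) :
    ‖Complex.exp (Complex.I * a) - 1 - Complex.I * a‖ ≤ a ^ 2 := by
  have := norm_exp_sub_one_sub_sub_le a 0
  rw [← sq_abs, sq]
  simpa only [Complex.ofReal_zero, mul_zero, Complex.exp_zero, sub_self, sub_zero, abs_zero,
    add_zero] using this

lemma IsLevyMeasure.integrable_sq {φ : Measure ℝ} (h : IsLevyMeasure φ)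
    (hφ : IntegrableOn (fun x : ℝ => x ^ 2) {x : ℝ | 1 < |x|} φ) :
    Integrable (fun x : ℝ => x ^ 2) φ := by
  have hm : MeasurableSet {x : ℝ | 1 < |x|} := measurableSet_lt measurable_const measurable_norm
  refine ((h.integrable).add (hφ.integrable_indicator hm)).mono' (by fun_prop) (.of_forall ?_)
  intro x
  by_cases hx : 1 < |x|
  · simp [hx]
    positivity
  · have : x ^ 2 ≤ 1 := by
      rw [← sq_abs]
      nlinarith [abs_nonneg x]
    simp [hx, this]

lemma integrable_compExponent {φ : Measure ℝ} (h : Integrable (fun x : ℝ => x ^ 2) φ) (θ : ℝ) :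
    Integrable (fun x : ℝ => Complex.exp (Complex.I * θ * x) - 1 - Complex.I * θ * x) φ := by
  refine (h.const_mul (θ ^ 2)).mono' (by fun_prop) (.of_forall fun x => ?_)
  have := norm_exp_sub_one_sub_le (θ * x)
  push_cast at this
  rw [← mul_assoc] at this
  rwa [mul_pow] at this

lemma norm_compExponent_sub_le {φ : Measure ℝ} (h : Integrable (fun x : ℝ => x ^ 2) φ)
    (a b : ℝ) :
    ‖compExponent φ a - compExponent φ b‖ ≤ (∫ x, x ^ 2 ∂φ) * (|a - b| * (|a| + |b|)) := by
  rw [compExponent, compExponent,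
    ← integral_sub (integrable_compExponent h a) (integrable_compExponent h b),
    ← integral_mul_const]
  refine norm_integral_le_of_norm_le (h.mul_const _) (.of_forall fun x => ?_)
  have := norm_exp_sub_one_sub_sub_le (a * x) (b * x)
  push_cast at this
  rw [← mul_assoc, ← mul_assoc] at this
  refine this.trans_eq ?_
  rw [← sub_mul, abs_mul, abs_mul, abs_mul, ← sq_abs x]
  ring

@[simp]
lemma compExponent_zero (φ : Measure ℝ) : compExponent φ 0 = 0 := by simp [compExponent]

/-- The part of the drift which the truncation function leaves over is the mean of the big jumps. -/
lemma levyExponent_eq {φ : Measure ℝ} (γ : ℝ) (h : Integrable (fun x : ℝ => x ^ 2) φ) (θ : ℝ) :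
    levyExponent γ 0 φ θ =
      Complex.I * ((γ + ∫ x in {x : ℝ | 1 < |x|}, x ∂φ : ℝ) : ℂ) * θ + compExponent φ θ := by
  have hm : MeasurableSet {x : ℝ | 1 < |x|} := measurableSet_lt measurable_const measurable_norm
  have hx : IntegrableOn (fun x : ℝ => x) {x : ℝ | 1 < |x|} φ := by
    refine Integrable.mono' h.integrableOn (by fun_prop) ?_
    filter_upwards [ae_restrict_mem hm] with x hx
    rw [← sq_abs, Real.norm_eq_abs]
    have hx' : 1 < |x| := hx
    nlinarith
  have hi : Integrable (fun x : ℝ => Complex.I * θ *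
      (({x : ℝ | 1 < |x|}.indicator (fun x => x) x : ℝ) : ℂ)) φ :=
    (hx.integrable_indicator hm).ofReal.const_mul _
  have : ∀ x : ℝ, (Complex.exp (Complex.I * θ * x) - 1 -
      (if |x| ≤ 1 then Complex.I * θ * x else 0)) =
      (Complex.exp (Complex.I * θ * x) - 1 - Complex.I * θ * x) +
      Complex.I * θ * (({x : ℝ | 1 < |x|}.indicator (fun x => x) x : ℝ) : ℂ) := by
    intro x
    by_cases hx : |x| ≤ 1
    · simp [hx, not_lt.2 hx]
    · simp [hx, not_le.1 hx]
  rw [levyExponent]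
  simp_rw [this]
  rw [integral_add (integrable_compExponent h θ) hi, integral_const_mul, integral_complex_ofReal,
    integral_indicator hm, compExponent]
  push_cast
  ring

/-- Comparing the derivatives at `0` of both sides of the Lévy-Khintchine formula at time `1`, the
linear term in the exponent is the mean, which vanishes. -/
lemma HasLevyTriplet.levyExponent_eq_compExponent {Ω : Type*} [MeasurableSpace Ω] {P : Measure Ω}
    [IsProbabilityMeasure P] {L : ℝ≥0 → Ω → ℝ} {γ : ℝ} {φ : Measure ℝ}
    (h : HasLevyTriplet P L γ 0 φ) (hc : IsCentered P L)
    (hφ : IntegrableOn (fun x : ℝ => x ^ 2) {x : ℝ | 1 < |x|} φ) :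
    levyExponent γ 0 φ = compExponent φ := by
  have h2 := h.isLevyMeasure.integrable_sq hφ
  obtain ⟨hi, h0⟩ := hc 1
  set m : ℝ := γ + ∫ x in {x : ℝ | 1 < |x|}, x ∂φ with hm
  have : IsProbabilityMeasure (P.map (L 1)) := Measure.isProbabilityMeasure_map hi.aemeasurable
  have hmem : MemLp id (1 : ℕ) (P.map (L 1)) := by
    rw [memLp_map_measure_iff (by fun_prop) hi.aemeasurable]
    simpa [memLp_one_iff_integrable] using hi
  have hchar : ∀ θ, charFun (P.map (L 1)) θ = Complex.exp (levyExponent γ 0 φ θ) := by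
    intro θ
    rw [charFun_apply_real, integral_map hi.aemeasurable (by fun_prop)]
    have := h.charFun_eq 1 θ
    simp only [NNReal.coe_one, Complex.ofReal_one, one_mul] at this
    rw [← this]
    congr with ω
    ring_nf
  have hd1 : HasDerivAt (charFun (P.map (L 1))) 0 0 := by
    have hd : DifferentiableAt ℝ (charFun (P.map (L 1))) 0 :=
      ((contDiff_charFun hmem).differentiable (by simp)).differentiableAt
    have := iteratedDeriv_charFun_zero hmem
    rw [iteratedDeriv_one] at this
    convert! hd.hasDerivAt using 1
    rw [this, integral_map hi.aemeasurable (by fun_prop)]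
    simp [h0]
  have hd2 : HasDerivAt (levyExponent γ 0 φ) (Complex.I * m) 0 := by
    have e : levyExponent γ 0 φ = fun θ : ℝ => Complex.I * m * θ + compExponent φ θ := by
      ext θ
      rw [levyExponent_eq γ h2]
    rw [e]
    have ha : HasDerivAt (fun θ : ℝ => Complex.I * m * (θ : ℂ)) (Complex.I * m * 1) 0 :=
      (Complex.ofRealCLM.hasDerivAt (x := 0)).const_mul _
    have hb : HasDerivAt (compExponent φ) 0 0 := by
      rw [hasDerivAt_iff_isLittleO]
      have hO : (fun x' : ℝ => compExponent φ x' - compExponent φ 0 - (x' - 0) • (0 : ℂ))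
          =O[𝓝 0] fun x' : ℝ => x' ^ 2 := by
        refine Asymptotics.IsBigO.of_bound (∫ x, x ^ 2 ∂φ) (.of_forall fun x => ?_)
        have := norm_compExponent_sub_le h2 x 0
        simpa [← sq] using this
      refine hO.trans_isLittleO ?_
      simpa using Asymptotics.isLittleO_pow_id (𝕜 := ℝ) (n := 2) (by norm_num)
    rw [mul_one] at ha
    have hab := ha.add hb
    rw [add_zero] at hab
    exact hab
  have hd3 : HasDerivAt (charFun (P.map (L 1))) (Complex.I * m) 0 := by
    have e : charFun (P.map (L 1)) = fun θ => Complex.exp (levyExponent γ 0 φ θ) := funext hchar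
    rw [e]
    have := hd2.cexp
    simpa [levyExponent_eq γ h2] using this
  have hm0 : m = 0 := by simpa using (hd3.unique hd1)
  ext θ
  rw [levyExponent_eq γ h2, ← hm, hm0]
  simp

/-! ### Integral functionals on `L²` -/

section

variable {ψ : ℝ → ℂ} {K : ℝ}

lemma continuous_of_norm_sub_le (hψ : ∀ a b, ‖ψ a - ψ b‖ ≤ K * (|a - b| * (|a| + |b|))) :
    Continuous ψ := by
  refine continuous_iff_continuousAt.2 fun b => ?_
  rw [ContinuousAt, tendsto_iff_norm_sub_tendsto_zero]
  refine squeeze_zero (fun _ => norm_nonneg _) (fun a => hψ a b) ?_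
  have : Continuous fun a : ℝ => K * (|a - b| * (|a| + |b|)) := by fun_prop
  simpa using this.tendsto b

lemma integrable_comp_of_memLp_two (hψ : ∀ a b, ‖ψ a - ψ b‖ ≤ K * (|a - b| * (|a| + |b|)))
    (h0 : ψ 0 = 0) {α : Type*} [MeasurableSpace α] {μ : Measure α} {g : α → ℝ}
    (hg : MemLp g 2 μ) : Integrable (fun u => ψ (g u)) μ := by
  refine (hg.integrable_sq.const_mul K).mono'
    ((continuous_of_norm_sub_le hψ).comp_aestronglyMeasurable hg.1) (.of_forall fun u => ?_)
  simpa [h0, ← sq] using hψ (g u) 0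

/-- The functional `g ↦ ∫ ψ(g(u)) du` is continuous on `L²` along any filter, by the Cauchy-Schwarz
inequality applied to `|g - h| (|g| + |h|)`. -/
lemma tendsto_integral_comp_of_tendsto_eLpNorm
    (hψ : ∀ a b, ‖ψ a - ψ b‖ ≤ K * (|a - b| * (|a| + |b|))) (h0 : ψ 0 = 0)
    {α : Type*} [MeasurableSpace α] {μ : Measure α} {ι : Type*} {l : Filter ι}
    {G : ι → α → ℝ} {g : α → ℝ} (hG : ∀ i, MemLp (G i) 2 μ) (hg : MemLp g 2 μ)
    (h : Tendsto (fun i => eLpNorm (G i - g) 2 μ) l (𝓝 0)) :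
    Tendsto (fun i => ∫ u, ψ (G i u) ∂μ) l (𝓝 (∫ u, ψ (g u) ∂μ)) := by
  rw [tendsto_iff_edist_tendsto_0]
  set c := eLpNorm g 2 μ with hc
  have hcfin : c ≠ ∞ := hg.2.ne
  have key : ∀ i, edist (∫ u, ψ (G i u) ∂μ) (∫ u, ψ (g u) ∂μ) ≤
      ENNReal.ofReal K * (eLpNorm (G i - g) 2 μ * (eLpNorm (G i - g) 2 μ + (c + c))) := by
    intro i
    rw [edist_eq_enorm_sub, ← integral_sub (integrable_comp_of_memLp_two hψ h0 (hG i))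
      (integrable_comp_of_memLp_two hψ h0 hg)]
    refine (enorm_integral_le_lintegral_enorm _).trans ?_
    have hd : MemLp (G i - g) 2 μ := (hG i).sub hg
    calc ∫⁻ u, ‖ψ (G i u) - ψ (g u)‖ₑ ∂μ
        ≤ ∫⁻ u, ENNReal.ofReal K *
            (‖(G i - g) u‖ₑ * (‖(G i - g) u‖ₑ + (‖g u‖ₑ + ‖g u‖ₑ))) ∂μ := by
          refine lintegral_mono fun u => ?_
          have h1 : ‖ψ (G i u) - ψ (g u)‖ₑ ≤
              ENNReal.ofReal (K * (|G i u - g u| * (|G i u| + |g u|))) := by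
            rw [← ofReal_norm]
            exact ENNReal.ofReal_le_ofReal (hψ _ _)
          refine h1.trans ?_
          rw [ENNReal.ofReal_mul' (by positivity), ENNReal.ofReal_mul (by positivity),
            ENNReal.ofReal_add (by positivity) (by positivity),
            ← Real.enorm_eq_ofReal_abs, ← Real.enorm_eq_ofReal_abs, ← Real.enorm_eq_ofReal_abs]
          have h2 : ‖G i u‖ₑ ≤ ‖(G i - g) u‖ₑ + ‖g u‖ₑ := by
            have := enorm_add_le ((G i - g) u) (g u)
            simpa using this
          rw [← add_assoc]
          exact mul_le_mul_right (mul_le_mul_right (add_le_add_left h2 _) _) _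
      _ = ENNReal.ofReal K *
            ∫⁻ u, ‖(G i - g) u‖ₑ * (‖(G i - g) u‖ₑ + (‖g u‖ₑ + ‖g u‖ₑ)) ∂μ :=
          lintegral_const_mul' _ _ ENNReal.ofReal_ne_top
      _ ≤ _ := by
          gcongr
          have hH := ENNReal.lintegral_mul_le_Lp_mul_Lq μ (p := 2) (q := 2)
            Real.HolderConjugate.two_two hd.1.enorm
            (hd.1.enorm.add (hg.1.enorm.add hg.1.enorm))
          have e1 : ∀ f : α → ℝ, eLpNorm f 2 μ = (∫⁻ u, ‖f u‖ₑ ^ (2 : ℝ) ∂μ) ^ (1 / (2 : ℝ)) := by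
            intro f
            rw [eLpNorm_eq_lintegral_rpow_enorm_toReal (by simp) (by simp)]
            simp
          refine hH.trans ?_
          rw [← e1]
          gcongr
          refine (ENNReal.lintegral_Lp_add_le hd.1.enorm (hg.1.enorm.add hg.1.enorm)
            (by norm_num)).trans ?_
          rw [← e1]
          gcongr
          refine (ENNReal.lintegral_Lp_add_le hg.1.enorm hg.1.enorm (by norm_num)).trans ?_
          rw [← e1]
  refine tendsto_of_tendsto_of_tendsto_of_le_of_le tendsto_const_nhds ?_ (fun _ => zero_le)
    key
  have h1 : Tendsto (fun i => eLpNorm (G i - g) 2 μ + (c + c)) l (𝓝 (0 + (c + c))) :=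
    h.add tendsto_const_nhds
  have h2 := ENNReal.Tendsto.const_mul (a := ENNReal.ofReal K)
    (ENNReal.Tendsto.mul h (.inr (by simp [hcfin])) h1 (.inr (by simp)))
    (.inr ENNReal.ofReal_ne_top)
  simpa using h2

lemma tendsto_eLpNorm_sum_mul_sub {α : Type*} [MeasurableSpace α] {μ : Measure α} {ι κ : Type*}
    [Fintype κ] {l : Filter ι} {c : ι → κ → ℝ} {c' : κ → ℝ} {G : ι → κ → α → ℝ}
    {g : κ → α → ℝ} (hc : ∀ j, Tendsto (fun i => c i j) l (𝓝 (c' j)))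
    (hG : ∀ i j, AEStronglyMeasurable (G i j) μ) (hg : ∀ j, MemLp (g j) 2 μ)
    (h : ∀ j, Tendsto (fun i => eLpNorm (G i j - g j) 2 μ) l (𝓝 0)) :
    Tendsto (fun i => eLpNorm ((fun u => ∑ j, c i j * G i j u) - fun u => ∑ j, c' j * g j u) 2 μ)
      l (𝓝 0) := by
  have key : ∀ i, eLpNorm ((fun u => ∑ j, c i j * G i j u) - fun u => ∑ j, c' j * g j u) 2 μ ≤
      ∑ j, (‖c i j‖ₑ * eLpNorm (G i j - g j) 2 μ + ‖c i j - c' j‖ₑ * eLpNorm (g j) 2 μ) := by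
    intro i
    have e : ((fun u => ∑ j, c i j * G i j u) - fun u => ∑ j, c' j * g j u) =
        ∑ j, (c i j • (G i j - g j) + (c i j - c' j) • g j) := by
      ext u
      simp only [Pi.sub_apply, Finset.sum_apply, Pi.add_apply, Pi.smul_apply, smul_eq_mul,
        ← Finset.sum_sub_distrib]
      exact Finset.sum_congr rfl fun j _ => by ring
    rw [e]
    have hm1 : ∀ j, AEStronglyMeasurable (c i j • (G i j - g j)) μ := fun j =>
      ((hG i j).sub (hg j).1).const_smul _
    have hm2 : ∀ j, MemLp ((c i j - c' j) • g j) 2 μ := fun j => (hg j).const_smul _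
    refine (eLpNorm_sum_le (fun j _ => (hm1 j).add (hm2 j).1) (by norm_num)).trans ?_
    refine Finset.sum_le_sum fun j _ => ?_
    refine (eLpNorm_add_le (hm1 j) (hm2 j).1 (by norm_num)).trans ?_
    rw [eLpNorm_const_smul, eLpNorm_const_smul]
  refine tendsto_of_tendsto_of_tendsto_of_le_of_le tendsto_const_nhds ?_ (fun _ => zero_le) key
  have hz : (0 : ℝ≥0∞) = ∑ _j : κ, 0 := by simp
  rw [hz]
  refine tendsto_finsetSum _ fun j _ => ?_
  have h1 : Tendsto (fun i => ‖c i j‖ₑ) l (𝓝 ‖c' j‖ₑ) := (hc j).enorm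
  have h2 : Tendsto (fun i => ‖c i j - c' j‖ₑ) l (𝓝 0) := by
    simpa using ((hc j).sub_const (c' j)).enorm
  have h3 := (ENNReal.Tendsto.mul h1 (.inr (by simp)) (h j) (.inr (by simp))).add
    (ENNReal.Tendsto.mul_const (b := eLpNorm (g j) 2 μ) h2 (.inr (hg j).2.ne))
  simpa using h3

end

/-! ### Step functions and increments -/

/-- The points of `E` in increasing order, continued by the constant `max E`. -/
lemma exists_monotone_enumeration {T : Type*} [LinearOrder T] (E : Finset T) (hE : E.Nonempty) :
    ∃ s : ℕ → T, Monotone s ∧ ∀ e ∈ E, ∃ i, s i = e := by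
  have hpos : 0 < E.card := hE.card_pos
  refine ⟨fun i => E.orderEmbOfFin rfl ⟨min i (E.card - 1), by omega⟩, ?_, ?_⟩
  · intro i j hij
    refine (E.orderEmbOfFin rfl).monotone ?_
    simp only [Fin.mk_le_mk]
    omega
  · intro e he
    have : e ∈ Set.range (E.orderEmbOfFin rfl) := by
      rw [Finset.range_orderEmbOfFin]
      exact he
    obtain ⟨i, rfl⟩ := this
    refine ⟨i, ?_⟩
    have hi : (⟨min (i : ℕ) (E.card - 1), by omega⟩ : Fin E.card) = i := Fin.ext (by simp; omega)
    simp only [hi]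

/-- A linear combination of increments is a linear combination of increments over consecutive
intervals, with nodes and coefficients that do not depend on the function `F`. -/
lemma exists_sum_increments_eq {T : Type*} [LinearOrder T] [Inhabited T] {κ : Type*} [Fintype κ]
    (c : κ → ℝ) (a b : κ → T) :
    ∃ (N : ℕ) (s : ℕ → T) (d : ℕ → ℝ), Monotone s ∧ ∀ F : T → ℝ,
      ∑ l, c l * (F (b l) - F (a l)) =
        ∑ i ∈ Finset.range N, d i * (F (s (i + 1)) - F (s i)) := by
  classical
  obtain ⟨s, hs, hE⟩ := exists_monotone_enumeration
    (insert default (Finset.univ.image a ∪ Finset.univ.image b)) (Finset.insert_nonempty _ _)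
  have ha : ∀ l, ∃ i, s i = a l := fun l => hE _ (by simp)
  have hb : ∀ l, ∃ i, s i = b l := fun l => hE _ (by simp)
  choose p hp using ha
  choose q hq using hb
  set N := ∑ l, (p l + q l) with hN
  have hle : ∀ l, p l + q l ≤ N := fun l =>
    Finset.single_le_sum (f := fun l => p l + q l) (fun _ _ => Nat.zero_le _) (Finset.mem_univ l)
  have tel : ∀ (F : T → ℝ) (m : ℕ), m ≤ N →
      ∑ i ∈ Finset.range N, (if i < m then (1 : ℝ) else 0) * (F (s (i + 1)) - F (s i)) =
        F (s m) - F (s 0) := by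
    intro F m hm
    rw [← Finset.sum_range_sub (fun i => F (s i)) m]
    simp only [ite_mul, one_mul, zero_mul]
    rw [← Finset.sum_filter]
    refine Finset.sum_congr ?_ fun _ _ => rfl
    ext i
    simp only [Finset.mem_filter, Finset.mem_range]
    omega
  refine ⟨N, s, fun i => ∑ l, c l *
    ((if i < q l then (1 : ℝ) else 0) - (if i < p l then (1 : ℝ) else 0)), hs, fun F => ?_⟩
  simp_rw [Finset.sum_mul]
  rw [Finset.sum_comm]
  refine Finset.sum_congr rfl fun l _ => ?_
  have h1 := tel F (q l) (by linarith [hle l])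
  have h2 := tel F (p l) (by linarith [hle l])
  rw [hq] at h1
  rw [hp] at h2
  have : F (b l) - F (a l) = (F (b l) - F (s 0)) - (F (a l) - F (s 0)) := by ring
  rw [this, ← h1, ← h2, ← Finset.sum_sub_distrib, Finset.mul_sum]
  exact Finset.sum_congr rfl fun i _ => by ring

/-- The number `1_{u ≤ t}`. For fixed `u`, its increment in `t` between `a ≤ b` is the indicator of
`(a, b]` at `u`, so step functions are linear combinations of increments just as their elementary
integrals are. -/
def leInd (u t : ℝ) : ℝ := if u ≤ t then 1 else 0

lemma leInd_sub_leInd {a b : ℝ} (hab : a ≤ b) (u : ℝ) :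
    leInd u b - leInd u a = (Set.Ioc a b).indicator (fun _ => (1 : ℝ)) u := by
  simp only [leInd, Set.indicator_apply, Set.mem_Ioc]
  split_ifs <;> grind

/-- The intervals `(s i, s (i + 1)]` are disjoint, so at most one term on either side is nonzero. -/
lemma comp_sum_increments {ψ : ℝ → ℂ} (h0 : ψ 0 = 0) (N : ℕ) {s : ℕ → ℝ} (hs : Monotone s)
    (d : ℕ → ℝ) (u : ℝ) :
    ψ (∑ i ∈ Finset.range N, d i * (leInd u (s (i + 1)) - leInd u (s i))) =
      ∑ i ∈ Finset.range N, (Set.Ioc (s i) (s (i + 1))).indicator (fun _ => ψ (d i)) u := by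
  simp only [fun i => leInd_sub_leInd (hs (Nat.le_succ i)) u]
  by_cases h : ∃ i ∈ Finset.range N, u ∈ Set.Ioc (s i) (s (i + 1))
  · obtain ⟨i, hi, hu⟩ := h
    have hne : ∀ j, j ≠ i → u ∉ Set.Ioc (s j) (s (j + 1)) := by
      intro j hj hu'
      rcases lt_or_gt_of_ne hj with hlt | hlt
      · exact absurd hu'.2 (not_le.2 ((hs hlt).trans_lt hu.1))
      · exact absurd hu.2 (not_le.2 ((hs hlt).trans_lt hu'.1))
    rw [Finset.sum_eq_single_of_mem i hi, Finset.sum_eq_single_of_mem i hi]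
    · simp [hu]
    · intro j _ hj
      simp [hne j hj]
    · intro j _ hj
      simp [hne j hj]
  · push Not at h
    rw [Finset.sum_eq_zero, Finset.sum_eq_zero, h0]
    · intro i hi
      exact Set.indicator_of_notMem (h i hi) _
    · intro i hi
      rw [Set.indicator_of_notMem (h i hi), mul_zero]

lemma integral_comp_sum_increments {ψ : ℝ → ℂ} (h0 : ψ 0 = 0) (N : ℕ) {s : ℕ → ℝ}
    (hs : Monotone s) (hs0 : 0 ≤ s 0) (d : ℕ → ℝ) :
    ∫ u in Set.Ioi (0 : ℝ),
        ψ (∑ i ∈ Finset.range N, d i * (leInd u (s (i + 1)) - leInd u (s i))) =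
      ∑ i ∈ Finset.range N, ((s (i + 1) - s i : ℝ) : ℂ) * ψ (d i) := by
  simp_rw [comp_sum_increments h0 N hs d]
  have hint : ∀ i, Integrable ((Set.Ioc (s i) (s (i + 1))).indicator fun _ => ψ (d i)) volume :=
    fun i => (integrable_indicator_iff measurableSet_Ioc).2 (integrableOn_const (by simp))
  rw [integral_finsetSum _ fun i _ => (hint i).integrableOn]
  refine Finset.sum_congr rfl fun i _ => ?_
  have hsub : Set.Ioc (s i) (s (i + 1)) ⊆ Set.Ioi 0 := fun u hu =>
    (hs0.trans (hs (Nat.zero_le i))).trans_lt hu.1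
  rw [setIntegral_indicator measurableSet_Ioc, Set.inter_eq_right.2 hsub, setIntegral_const]
  simp [Measure.real, ENNReal.toReal_ofReal (sub_nonneg.2 (hs (Nat.le_succ i)))]

/-! ### Increments of one- and two-sided Lévy processes -/

variable {Ω : Type*} [MeasurableSpace Ω] {P : Measure Ω}

/-- The characteristic function of a linear combination of increments of a Lévy process with
exponent `ψ` integrates `ψ` along the step function with these coefficients. -/
lemma IsLevyProcess.charFun_sum_increments {L : ℝ≥0 → Ω → ℝ} (hL : IsLevyProcess P L)
    {ψ : ℝ → ℂ} (h0 : ψ 0 = 0)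
    (hψ : ∀ (t : ℝ≥0) (θ : ℝ),
      ∫ ω, Complex.exp (Complex.I * θ * L t ω) ∂P = Complex.exp ((t : ℂ) * ψ θ))
    {κ : Type*} [Fintype κ] (c : κ → ℝ) (a b : κ → ℝ≥0) :
    ∫ ω, Complex.exp (Complex.I * ((∑ l, c l * (L (b l) ω - L (a l) ω) : ℝ) : ℂ)) ∂P =
      Complex.exp (∫ u in Set.Ioi (0 : ℝ), ψ (∑ l, c l * (leInd u (b l) - leInd u (a l)))) := by
  obtain ⟨N, s, d, hs, h⟩ := exists_sum_increments_eq c a b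
  have hs' : Monotone fun i => (s i : ℝ) := fun i j hij => by exact_mod_cast hs hij
  have e1 : ∀ u : ℝ, ∑ l, c l * (leInd u (b l) - leInd u (a l)) =
      ∑ i ∈ Finset.range N, d i * (leInd u (s (i + 1)) - leInd u (s i)) :=
    fun u => h fun t => leInd u t
  have e2 : ∀ ω, ∑ l, c l * (L (b l) ω - L (a l) ω) =
      ∑ i ∈ Finset.range N, d i * (L (s (i + 1)) ω - L (s i) ω) := fun ω => h fun t => L t ω
  simp_rw [e1, e2]
  rw [integral_comp_sum_increments h0 N hs' (NNReal.coe_nonneg _) d, Complex.exp_sum]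
  have hind : iIndepFun (fun (i : Fin N) ω =>
      Complex.exp (Complex.I * d i * ((L (s (i + 1)) ω - L (s i) ω : ℝ) : ℂ))) P := by
    have := (hL.indep_increments.nat hs).precomp (g := fun i : Fin N => (i : ℕ))
      Fin.val_injective
    exact this.comp (fun (i : Fin N) (x : ℝ) => Complex.exp (Complex.I * d i * (x : ℂ)))
      fun i => by fun_prop
  have hm := hL.measurable
  have hprod := hind.integral_fun_prod_eq_prod_integral
    fun i => (by fun_prop : AEStronglyMeasurable _ _)
  rw [← Fin.prod_univ_eq_prod_range (fun i => Complex.exp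
    (((((s (i + 1) : ℝ) - s i : ℝ)) : ℂ) * ψ (d i))) N]
  have e3 : ∀ ω, Complex.exp (Complex.I *
      ((∑ i ∈ Finset.range N, d i * (L (s (i + 1)) ω - L (s i) ω) : ℝ) : ℂ)) =
      ∏ i : Fin N, Complex.exp (Complex.I * d i * ((L (s (i + 1)) ω - L (s i) ω : ℝ) : ℂ)) := by
    intro ω
    rw [← Complex.exp_sum, ← Fin.sum_univ_eq_sum_range
      (fun i => d i * (L (s (i + 1)) ω - L (s i) ω)) N]
    push_cast
    rw [Finset.mul_sum]
    congr 1
    exact Finset.sum_congr rfl fun i _ => by ring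
  simp_rw [e3]
  rw [hprod]
  refine Finset.prod_congr rfl fun i _ => ?_
  have hst := hL.stationary_increments (s i) (s (i + 1) - s i)
  have hle : s i ≤ s (i + 1) := hs (Nat.le_succ i)
  rw [add_tsub_cancel_of_le hle] at hst
  have := (hst.comp (u := fun x : ℝ => Complex.exp (Complex.I * d i * (x : ℂ)))
    (by fun_prop)).integral_eq
  simp only [Function.comp_def] at this
  rw [this, hψ]
  push_cast [NNReal.coe_sub hle]
  rfl

/-- Stochastic continuity rules out fixed jumps: the left limit at a fixed time is almost surely
the value. -/
lemma IsLevyProcess.leftLim_ae_eq {L : ℝ≥0 → Ω → ℝ} (hL : IsLevyProcess P L) (t : ℝ≥0)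
    (ht : 0 < t) : (fun ω => Function.leftLim (fun s => L s ω) t) =ᵐ[P] L t := by
  have hne : (𝓝[<] t).NeBot := nhdsLT_neBot_of_exists_lt ⟨0, ht⟩
  have hmeas : TendstoInMeasure P L (𝓝[<] t) (L t) := fun ε hε =>
    (hL.stochastically_continuous t ε hε).mono_left nhdsWithin_le_nhds
  obtain ⟨ns, hns, hae⟩ := hmeas.exists_seq_tendsto_ae'
  filter_upwards [hae, hL.cadlag] with ω h1 h2
  obtain ⟨l, hl⟩ := (h2 t).2
  rw [leftLim_eq_of_tendsto hl]
  exact tendsto_nhds_unique (hl.comp hns) h1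

/-- With `t⁺` and `t⁻` the positive and negative parts of `t`, almost surely
`L t = L₁ (t⁺) - L₂ (t⁻)`, because both processes start at `0` and have no fixed jumps. -/
lemma twoSided_ae_eq {L₁ L₂ : ℝ≥0 → Ω → ℝ} (hL₁ : IsLevyProcess P L₁)
    (hL₂ : IsLevyProcess P L₂) (t : ℝ) :
    twoSided L₁ L₂ t =ᵐ[P] fun ω => L₁ t.toNNReal ω - L₂ (-t).toNNReal ω := by
  rcases le_or_gt 0 t with ht | ht
  · filter_upwards [hL₂.zero] with ω h
    rw [twoSided, if_pos ht, Real.toNNReal_of_nonpos (neg_nonpos.2 ht), h, sub_zero]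
  · filter_upwards [hL₁.zero, hL₂.leftLim_ae_eq (-t).toNNReal (by simpa using ht)] with ω h h'
    rw [twoSided, if_neg (not_le.2 ht), h', Real.toNNReal_of_nonpos ht.le, h, zero_sub]

/-- Splitting each increment at time `0` gives two independent linear combinations of increments,
one of `L₁` and one of `L₂`; the latter is moved to the negative half-line by reflection. -/
lemma charFun_sum_increments_twoSided {L₁ L₂ : ℝ≥0 → Ω → ℝ} (hL₁ : IsLevyProcess P L₁)
    (hL₂ : IsLevyProcess P L₂) (hcopy : IsIndepCopy P L₁ L₂) {ψ : ℝ → ℂ} (h0 : ψ 0 = 0)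
    (hψ : ∀ (t : ℝ≥0) (θ : ℝ),
      ∫ ω, Complex.exp (Complex.I * θ * L₁ t ω) ∂P = Complex.exp ((t : ℂ) * ψ θ))
    {κ : Type*} [Fintype κ] (c : κ → ℝ) (a b : κ → ℝ)
    (hint : Integrable fun u => ψ (∑ l, c l * (leInd u (b l) - leInd u (a l)))) :
    ∫ ω, Complex.exp (Complex.I *
        ((∑ l, c l * (twoSided L₁ L₂ (b l) ω - twoSided L₁ L₂ (a l) ω) : ℝ) : ℂ)) ∂P =
      Complex.exp (∫ u, ψ (∑ l, c l * (leInd u (b l) - leInd u (a l)))) := by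
  have hψ₂ : ∀ (t : ℝ≥0) (θ : ℝ),
      ∫ ω, Complex.exp (Complex.I * θ * L₂ t ω) ∂P = Complex.exp ((t : ℂ) * ψ θ) := by
    intro t θ
    rw [← hψ]
    exact ((hcopy.identDistrib.comp (u := fun x : ℝ≥0 → ℝ =>
      Complex.exp (Complex.I * θ * (x t : ℂ))) (by fun_prop)).integral_eq).symm
  have e : ∀ᵐ ω ∂P, ∀ l, c l * (twoSided L₁ L₂ (b l) ω - twoSided L₁ L₂ (a l) ω) =
      c l * (L₁ (b l).toNNReal ω - L₁ (a l).toNNReal ω) +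
        -c l * (L₂ (-b l).toNNReal ω - L₂ (-a l).toNNReal ω) := by
    refine ae_all_iff.2 fun l => ?_
    filter_upwards [twoSided_ae_eq hL₁ hL₂ (a l), twoSided_ae_eq hL₁ hL₂ (b l)] with ω h h'
    rw [h, h']
    ring
  have h1 := hL₁.charFun_sum_increments h0 hψ c (fun l => (a l).toNNReal)
    (fun l => (b l).toNNReal)
  have h2 := hL₂.charFun_sum_increments h0 hψ₂ (fun l => -c l) (fun l => (-a l).toNNReal)
    (fun l => (-b l).toNNReal)
  have i1 : ∫ u in Set.Ioi (0 : ℝ), ψ (∑ l, c l *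
        (leInd u ((b l).toNNReal : ℝ) - leInd u ((a l).toNNReal : ℝ))) =
      ∫ u in Set.Ioi (0 : ℝ), ψ (∑ l, c l * (leInd u (b l) - leInd u (a l))) := by
    refine setIntegral_congr_fun measurableSet_Ioi fun u hu => ?_
    have hle : ∀ t : ℝ, leInd u (t.toNNReal : ℝ) = leInd u t := fun t => by
      simp [leInd, Real.coe_toNNReal', not_le.2 (Set.mem_Ioi.1 hu)]
    simp only [hle]
  have i2 : ∫ u in Set.Ioi (0 : ℝ), ψ (∑ l, -c l *
        (leInd u ((-b l).toNNReal : ℝ) - leInd u ((-a l).toNNReal : ℝ))) =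
      ∫ u in Set.Iic (0 : ℝ), ψ (∑ l, c l * (leInd u (b l) - leInd u (a l))) := by
    have hr := integral_comp_neg_Ioi (0 : ℝ)
      (fun u => ψ (∑ l, c l * (leInd u (b l) - leInd u (a l))))
    rw [neg_zero] at hr
    rw [← hr]
    refine setIntegral_congr_ae measurableSet_Ioi ?_
    -- the half-open intervals change their closed endpoint under reflection
    have hnull : ∀ᵐ u : ℝ, ∀ l, u ≠ -b l ∧ u ≠ -a l :=
      ae_all_iff.2 fun l => (Measure.ae_ne volume _).and (Measure.ae_ne volume _)
    filter_upwards [hnull] with u hu hpos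
    congr 1
    refine Finset.sum_congr rfl fun l _ => ?_
    have hle : ∀ t : ℝ, u ≠ -t → leInd u ((-t).toNNReal : ℝ) = 1 - leInd (-u) t := by
      intro t ht
      have h3 : (u ≤ ((-t).toNNReal : ℝ)) ↔ ¬ (-u ≤ t) := by
        rw [Real.coe_toNNReal', le_max_iff, or_iff_left (not_le.2 (Set.mem_Ioi.1 hpos)), not_le]
        constructor
        · intro h
          have := lt_of_le_of_ne h ht
          linarith
        · intro h
          linarith
      simp only [leInd, h3]
      split_ifs <;> simp_all
    rw [hle _ (hu l).1, hle _ (hu l).2]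
    ring
  rw [i1] at h1
  rw [i2] at h2
  have hind := hcopy.indep.comp
    (φ := fun x : ℝ≥0 → ℝ => Complex.exp (Complex.I *
      ((∑ l, c l * (x (b l).toNNReal - x (a l).toNNReal) : ℝ) : ℂ)))
    (ψ := fun x : ℝ≥0 → ℝ => Complex.exp (Complex.I *
      ((∑ l, -c l * (x (-b l).toNNReal - x (-a l).toNNReal) : ℝ) : ℂ)))
    (by fun_prop) (by fun_prop)
  have hm1 := hL₁.measurable
  have hm2 := hL₂.measurable
  have hmul := hind.integral_fun_mul_eq_mul_integral (by fun_prop) (by fun_prop)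
  simp only [Function.comp_def] at hmul
  rw [h1, h2, ← Complex.exp_add, add_comm,
    intervalIntegral.integral_Iic_add_Ioi hint.integrableOn hint.integrableOn] at hmul
  rw [← hmul]
  refine integral_congr_ae ?_
  filter_upwards [e] with ω hω
  rw [← Complex.exp_add, Finset.sum_congr rfl fun l _ => hω l, Finset.sum_add_distrib]
  push_cast
  ring_nf

/-! ### Characteristic functions and infinite divisibility -/

/-- Lévy's continuity theorem: a pointwise limit of characteristic functions that is continuous at
`0` is a characteristic function. The continuity gives tightness, and any cluster point has the
right characteristic function. -/
lemma exists_charFun_eq_of_tendsto {E : Type*} [NormedAddCommGroup E] [InnerProductSpace ℝ E]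
    [FiniteDimensional ℝ E] [MeasurableSpace E] [BorelSpace E] (μ : ℕ → ProbabilityMeasure E)
    {F : E → ℂ} (hF : ContinuousAt F 0)
    (h : ∀ t, Tendsto (fun m => charFun (μ m : Measure E) t) atTop (𝓝 (F t))) :
    ∃ μ₀ : ProbabilityMeasure E, ∀ t, charFun (μ₀ : Measure E) t = F t := by
  have htight : IsTightMeasureSet {(μ m : Measure E) | m} :=
    isTightMeasureSet_of_tendsto_charFun (μ := fun m => (μ m : Measure E)) hF h
  have hcomp : IsCompact (closure {μ m | m}) :=
    isCompact_closure_of_isTightMeasureSet (by simpa using htight)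
  obtain ⟨μ₀, -, hμ₀⟩ := hcomp.ultrafilter_le_nhds ((hyperfilter ℕ).map μ)
    (.trans (by simp) (principal_mono.2 subset_closure))
  have hμ₀' : Tendsto μ (hyperfilter ℕ) (𝓝 μ₀) := hμ₀
  refine ⟨μ₀, fun t => ?_⟩
  rw [ProbabilityMeasure.tendsto_iff_forall_integral_rclike_tendsto ℂ] at hμ₀'
  have h1 := hμ₀' (BoundedContinuousFunction.innerProbChar t)
  simp_rw [← charFun_eq_integral_innerProbChar] at h1
  exact tendsto_nhds_unique h1 ((h t).mono_left Nat.hyperfilter_le_atTop)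

lemma charFun_map_toLp {k : ℕ} (ν : Measure (Fin k → ℝ)) (t : EuclideanSpace ℝ (Fin k)) :
    charFun (ν.map (WithLp.toLp 2)) t =
      ∫ x, Complex.exp (Complex.I * ((∑ j, t j * x j : ℝ) : ℂ)) ∂ν := by
  rw [charFun_apply, ← MeasurableEquiv.coe_toLp, integral_map_equiv]
  congr with x
  rw [PiLp.inner_apply, mul_comm]
  simp

/-- Lévy's continuity theorem on `Fin k → ℝ`, producing the limit law. -/
lemma exists_law_of_tendsto_integral_exp {k : ℕ} (ν : ℕ → Measure (Fin k → ℝ))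
    [∀ m, IsProbabilityMeasure (ν m)] {F : (Fin k → ℝ) → ℂ} (hF : Continuous F)
    (h : ∀ θ : Fin k → ℝ, Tendsto
      (fun m => ∫ x, Complex.exp (Complex.I * ((∑ j, θ j * x j : ℝ) : ℂ)) ∂(ν m)) atTop
      (𝓝 (F θ))) :
    ∃ ν₀ : Measure (Fin k → ℝ), IsProbabilityMeasure ν₀ ∧
      ∀ θ : Fin k → ℝ, ∫ x, Complex.exp (Complex.I * ((∑ j, θ j * x j : ℝ) : ℂ)) ∂ν₀ = F θ := by
  obtain ⟨μ₀, hμ₀⟩ := exists_charFun_eq_of_tendsto (E := EuclideanSpace ℝ (Fin k))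
    (fun m => ⟨(ν m).map (WithLp.toLp 2), Measure.isProbabilityMeasure_map (by fun_prop)⟩)
    (F := fun t => F t.ofLp) (hF.comp (PiLp.continuous_ofLp 2 _)).continuousAt
    (fun t => by
      simp only [ProbabilityMeasure.coe_mk, charFun_map_toLp]
      exact h _)
  refine ⟨(μ₀ : Measure (EuclideanSpace ℝ (Fin k))).map WithLp.ofLp,
    Measure.isProbabilityMeasure_map (by fun_prop), fun θ => ?_⟩
  have := hμ₀ (WithLp.toLp 2 θ)
  simp only at this
  rw [← this, ← charFun_map_toLp _ (WithLp.toLp 2 θ),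
    Measure.map_map (by fun_prop) (by fun_prop)]
  simp [Function.comp_def]

/-- A continuous linear functional on `Fin k → ℝ` is given by its values on the standard basis. -/
lemma charFunDual_eq_integral_exp {k : ℕ} (ν : Measure (Fin k → ℝ))
    (T : StrongDual ℝ (Fin k → ℝ)) : charFunDual ν T =
      ∫ x, Complex.exp (Complex.I * ((∑ j, T (Pi.single j 1) * x j : ℝ) : ℂ)) ∂ν := by
  rw [charFunDual_apply]
  congr with x
  rw [mul_comm]
  congr 3
  conv_lhs => rw [← Finset.univ_sum_single x, map_sum]
  refine Finset.sum_congr rfl fun j _ => ?_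
  have : (Pi.single j (x j) : Fin k → ℝ) = x j • Pi.single j 1 := by
    rw [← Pi.single_smul', smul_eq_mul, mul_one]
  rw [this, map_smul, smul_eq_mul, mul_comm]

/-- A law with characteristic function `exp ψ` is infinitely divisible as soon as every
`exp (ψ / n)` is a characteristic function. -/
lemma isInfinitelyDivisible_of_charFun {k : ℕ} {μ : Measure (Fin k → ℝ)} [IsProbabilityMeasure μ]
    {Ψ : (Fin k → ℝ) → ℂ}
    (hμ : ∀ θ : Fin k → ℝ,
      ∫ x, Complex.exp (Complex.I * ((∑ j, θ j * x j : ℝ) : ℂ)) ∂μ = Complex.exp (Ψ θ))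
    (h : ∀ n : ℕ, 0 < n → ∃ ν : Measure (Fin k → ℝ), IsProbabilityMeasure ν ∧
      ∀ θ : Fin k → ℝ, ∫ x, Complex.exp (Complex.I * ((∑ j, θ j * x j : ℝ) : ℂ)) ∂ν =
        Complex.exp ((n : ℂ)⁻¹ * Ψ θ)) :
    IsInfinitelyDivisible μ := by
  intro n hn
  obtain ⟨ν, hν, hνe⟩ := h n hn
  refine ⟨ν, hν, ?_⟩
  have : IsProbabilityMeasure ((Measure.pi fun _ : Fin n => ν).map fun x => ∑ i, x i) :=
    Measure.isProbabilityMeasure_map (by fun_prop)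
  refine Measure.ext_of_charFunDual ?_
  ext T
  rw [charFunDual_map_sum_pi_eq_prod, Finset.prod_apply]
  simp only [charFunDual_eq_integral_exp, hμ, hνe, Finset.prod_const, Finset.card_univ,
    Fintype.card_fin, ← Complex.exp_nat_mul]
  rw [← mul_assoc, mul_inv_cancel₀ (by exact_mod_cast hn.ne'), one_mul]

/-! ### Lévy integrals -/

lemma StepFunction.eval_eq (G : StepFunction) (u : ℝ) :
    G.eval u = ∑ i, G.coef i * (leInd u (G.node i.succ) - leInd u (G.node i.castSucc)) := by
  refine Finset.sum_congr rfl fun i _ => ?_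
  rw [leInd_sub_leInd (G.mono (Fin.castSucc_lt_succ).le), Set.indicator_apply, Set.indicator_apply]
  split_ifs <;> simp

lemma StepFunction.memLp_eval (G : StepFunction) : MemLp G.eval 2 volume := by
  have : G.eval = fun u => ∑ i : Fin G.n,
    (Set.Ioc (G.node i.castSucc) (G.node i.succ)).indicator (fun _ => G.coef i) u := rfl
  rw [this]
  exact memLp_finsetSum _ fun i _ =>
    memLp_indicator_const 2 measurableSet_Ioc _ (.inr (by simp))

/-- The step function `u ↦ G (r u)`. -/
def StepFunction.rescale (G : StepFunction) (r : ℝ) (hr : 0 < r) : StepFunction where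
  n := G.n
  node i := G.node i / r
  mono _ _ hij := div_le_div_of_nonneg_right (G.mono hij) hr.le
  coef := G.coef

lemma StepFunction.eval_rescale (G : StepFunction) (r : ℝ) (hr : 0 < r) (u : ℝ) :
    (G.rescale r hr).eval u = G.eval (r * u) := by
  have h : ∀ t, leInd u (t / r) = leInd (r * u) t := fun t => by
    simp only [leInd, le_div_iff₀ hr, mul_comm]
  rw [StepFunction.eval_eq, StepFunction.eval_eq]
  exact Finset.sum_congr rfl fun i _ => by simp only [rescale, h]

lemma aestronglyMeasurable_twoSided {L₁ L₂ : ℝ≥0 → Ω → ℝ} (hL₁ : IsLevyProcess P L₁)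
    (hL₂ : IsLevyProcess P L₂) (t : ℝ) : AEStronglyMeasurable (twoSided L₁ L₂ t) P := by
  have h1 := hL₁.measurable
  have h2 := hL₂.measurable
  exact (by fun_prop : AEStronglyMeasurable
    (fun ω => L₁ t.toNNReal ω - L₂ (-t).toNNReal ω) P).congr (twoSided_ae_eq hL₁ hL₂ t).symm

lemma StepFunction.aestronglyMeasurable_integral (G : StepFunction) {L : ℝ → Ω → ℝ}
    (hL : ∀ t, AEStronglyMeasurable (L t) P) : AEStronglyMeasurable (G.integral L) P := by
  unfold StepFunction.integral
  fun_prop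

variable {L₁ L₂ : ℝ≥0 → Ω → ℝ} {ψ : ℝ → ℂ} {K : ℝ}

/-- The step functions `G j` may have different nodes: together they are one linear combination of
increments, indexed by the pairs of `j` and a step of `G j`. -/
lemma charFun_stepFunction_integral (hL₁ : IsLevyProcess P L₁)
    (hL₂ : IsLevyProcess P L₂) (hcopy : IsIndepCopy P L₁ L₂)
    (hK : ∀ a b, ‖ψ a - ψ b‖ ≤ K * (|a - b| * (|a| + |b|))) (h0 : ψ 0 = 0)
    (hψ : ∀ (t : ℝ≥0) (θ : ℝ),
      ∫ ω, Complex.exp (Complex.I * θ * L₁ t ω) ∂P = Complex.exp ((t : ℂ) * ψ θ))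
    {k : ℕ} (G : Fin k → StepFunction) (θ : Fin k → ℝ) :
    ∫ ω, Complex.exp (Complex.I *
        ((∑ j, θ j * (G j).integral (twoSided L₁ L₂) ω : ℝ) : ℂ)) ∂P =
      Complex.exp (∫ u, ψ (∑ j, θ j * (G j).eval u)) := by
  have e1 : ∀ u, ∑ j, θ j * (G j).eval u = ∑ l : (Σ j, Fin (G j).n),
      θ l.1 * (G l.1).coef l.2 *
        (leInd u ((G l.1).node l.2.succ) - leInd u ((G l.1).node l.2.castSucc)) := by
    intro u
    rw [Fintype.sum_sigma]
    simp only [StepFunction.eval_eq, Finset.mul_sum, mul_assoc]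
  have e2 : ∀ ω, ∑ j, θ j * (G j).integral (twoSided L₁ L₂) ω = ∑ l : (Σ j, Fin (G j).n),
      θ l.1 * (G l.1).coef l.2 * (twoSided L₁ L₂ ((G l.1).node l.2.succ) ω -
        twoSided L₁ L₂ ((G l.1).node l.2.castSucc) ω) := by
    intro ω
    rw [Fintype.sum_sigma]
    simp only [StepFunction.integral, Finset.mul_sum, mul_assoc]
  have hint : Integrable (fun u => ψ (∑ j, θ j * (G j).eval u)) :=
    integrable_comp_of_memLp_two hK h0
      (memLp_finsetSum _ fun j _ => ((G j).memLp_eval).const_mul (θ j))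
  simp_rw [e1] at hint ⊢
  simp_rw [e2]
  exact charFun_sum_increments_twoSided hL₁ hL₂ hcopy h0 hψ _ _ _ hint

lemma tendsto_integral_comp_stepFunction
    (hK : ∀ a b, ‖ψ a - ψ b‖ ≤ K * (|a - b| * (|a| + |b|))) (h0 : ψ 0 = 0)
    {k : ℕ} {G : ℕ → Fin k → StepFunction} {g : Fin k → ℝ → ℝ} (hg : ∀ j, MemLp (g j) 2 volume)
    (hG : ∀ j, Tendsto (fun m => eLpNorm (fun u => (G m j).eval u - g j u) 2 volume) atTop (𝓝 0))
    (θ : Fin k → ℝ) :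
    Tendsto (fun m => ∫ u, ψ (∑ j, θ j * (G m j).eval u)) atTop
      (𝓝 (∫ u, ψ (∑ j, θ j * g j u))) := by
  refine tendsto_integral_comp_of_tendsto_eLpNorm hK h0
    (fun m => memLp_finsetSum _ fun j _ => ((G m j).memLp_eval).const_mul (θ j))
    (memLp_finsetSum _ fun j _ => (hg j).const_mul (θ j)) ?_
  exact tendsto_eLpNorm_sum_mul_sub (c := fun _ => θ) (G := fun m j => (G m j).eval)
    (fun _ => tendsto_const_nhds) (fun m j => (G m j).memLp_eval.1) hg hG

lemma continuous_integral_comp_sum (hK : ∀ a b, ‖ψ a - ψ b‖ ≤ K * (|a - b| * (|a| + |b|)))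
    (h0 : ψ 0 = 0) {k : ℕ} {g : Fin k → ℝ → ℝ} (hg : ∀ j, MemLp (g j) 2 volume) :
    Continuous fun θ : Fin k → ℝ => ∫ u, ψ (∑ j, θ j * g j u) := by
  refine continuous_iff_continuousAt.2 fun θ => ?_
  refine tendsto_integral_comp_of_tendsto_eLpNorm hK h0
    (fun m => memLp_finsetSum _ fun j _ => (hg j).const_mul (m j))
    (memLp_finsetSum _ fun j _ => (hg j).const_mul (θ j)) ?_
  refine tendsto_eLpNorm_sum_mul_sub (c := fun i => i) (G := fun _ j => g j)
    (fun j => (continuous_apply j).tendsto θ) (fun _ j => (hg j).1) hg fun j => ?_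
  simp

/-- The function `x ↦ exp(ix)` is `1`-Lipschitz, and the `L¹` norm is at most the `L²` norm. The
variables `Y m` are not assumed to be square integrable. -/
lemma tendsto_integral_exp_of_tendsto_eLpNorm [IsProbabilityMeasure P] {Y : ℕ → Ω → ℝ}
    {Z : Ω → ℝ} (hY : ∀ m, AEStronglyMeasurable (Y m) P) (hZ : AEStronglyMeasurable Z P)
    (h : Tendsto (fun m => eLpNorm (Y m - Z) 2 P) atTop (𝓝 0)) :
    Tendsto (fun m => ∫ ω, Complex.exp (Complex.I * (Y m ω : ℂ)) ∂P) atTop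
      (𝓝 (∫ ω, Complex.exp (Complex.I * (Z ω : ℂ)) ∂P)) := by
  have hi : ∀ {W : Ω → ℝ}, AEStronglyMeasurable W P →
      Integrable (fun ω => Complex.exp (Complex.I * (W ω : ℂ))) P := by
    intro W hW
    refine (integrable_const (1 : ℝ)).mono' (by fun_prop) (.of_forall fun ω => ?_)
    rw [Complex.norm_exp_I_mul_ofReal]
  rw [tendsto_iff_edist_tendsto_0]
  refine tendsto_of_tendsto_of_tendsto_of_le_of_le tendsto_const_nhds h (fun _ => zero_le)
    fun m => ?_
  rw [edist_eq_enorm_sub, ← integral_sub (hi (hY m)) (hi hZ)]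
  refine (enorm_integral_le_lintegral_enorm _).trans ?_
  refine le_trans ?_ (eLpNorm_le_eLpNorm_of_exponent_le (p := 1) (by norm_num) ((hY m).sub hZ))
  rw [eLpNorm_one_eq_lintegral_enorm]
  refine lintegral_mono fun ω => ?_
  have e : Complex.exp (Complex.I * (Y m ω : ℂ)) - Complex.exp (Complex.I * (Z ω : ℂ)) =
      Complex.exp (Complex.I * (Z ω : ℂ)) *
        (Complex.exp (Complex.I * ((Y m ω - Z ω : ℝ) : ℂ)) - 1) := by
    rw [mul_sub, ← Complex.exp_add, mul_one]
    push_cast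
    ring_nf
  rw [e, enorm_mul, Complex.enorm_exp_I_mul_ofReal, one_mul]
  exact Real.enorm_exp_I_mul_ofReal_sub_one_le

/-- The log-characteristic function of a vector of Lévy integrals: pass to the limit on both sides
of the formula for step functions. -/
lemma isLogCharFun_of_isLevyIntegral [IsProbabilityMeasure P] (hL₁ : IsLevyProcess P L₁)
    (hL₂ : IsLevyProcess P L₂) (hcopy : IsIndepCopy P L₁ L₂)
    (hK : ∀ a b, ‖ψ a - ψ b‖ ≤ K * (|a - b| * (|a| + |b|))) (h0 : ψ 0 = 0)
    (hψ : ∀ (t : ℝ≥0) (θ : ℝ),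
      ∫ ω, Complex.exp (Complex.I * θ * L₁ t ω) ∂P = Complex.exp ((t : ℂ) * ψ θ))
    {k : ℕ} {g : Fin k → ℝ → ℝ} (hg : ∀ j, MemLp (g j) 2 volume) {Y : Fin k → Ω → ℝ}
    (hY : ∀ j, IsLevyIntegral P (twoSided L₁ L₂) (g j) (Y j)) :
    IsLogCharFun P Y fun θ => ∫ u, ψ (∑ j, θ j * g j u) where
  continuous := continuous_integral_comp_sum hK h0 hg
  zero := by simp [h0]
  charFun_eq θ := by
    choose hYm G hG hGY using hY
    have hL := aestronglyMeasurable_twoSided hL₁ hL₂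
    have h1 := (tendsto_integral_comp_stepFunction hK h0 (G := fun m j => G j m) hg hG θ).cexp
    have h2 : Tendsto (fun m => ∫ ω, Complex.exp (Complex.I *
        ((∑ j, θ j * (G j m).integral (twoSided L₁ L₂) ω : ℝ) : ℂ)) ∂P) atTop
        (𝓝 (∫ ω, Complex.exp (Complex.I * ((∑ j, θ j * Y j ω : ℝ) : ℂ)) ∂P)) := by
      have hGm := fun j m => (G j m).aestronglyMeasurable_integral hL
      refine tendsto_integral_exp_of_tendsto_eLpNorm
        (fun m => Finset.aestronglyMeasurable_fun_sum _ fun j _ => (hGm j m).const_mul (θ j))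
        (Finset.aestronglyMeasurable_fun_sum _ fun j _ => (hYm j).1.const_mul (θ j)) ?_
      exact tendsto_eLpNorm_sum_mul_sub (c := fun _ => θ)
        (G := fun m j => (G j m).integral (twoSided L₁ L₂))
        (fun _ => tendsto_const_nhds) (fun m j => hGm j m) hYm hGY
    simp_rw [charFun_stepFunction_integral hL₁ hL₂ hcopy hK h0 hψ (fun j => G j _)] at h2
    exact tendsto_nhds_unique h2 h1

/-- The `n`-th root of the law of a vector of Lévy integrals of `g j` is the law of the Lévy
integrals of `u ↦ g j (n u)`, here obtained as the limit law of step function integrals. -/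
lemma isInfinitelyDivisible_of_isLevyIntegral [IsProbabilityMeasure P]
    (hL₁ : IsLevyProcess P L₁)
    (hL₂ : IsLevyProcess P L₂) (hcopy : IsIndepCopy P L₁ L₂)
    (hK : ∀ a b, ‖ψ a - ψ b‖ ≤ K * (|a - b| * (|a| + |b|))) (h0 : ψ 0 = 0)
    (hψ : ∀ (t : ℝ≥0) (θ : ℝ),
      ∫ ω, Complex.exp (Complex.I * θ * L₁ t ω) ∂P = Complex.exp ((t : ℂ) * ψ θ))
    {k : ℕ} {g : Fin k → ℝ → ℝ} (hg : ∀ j, MemLp (g j) 2 volume) {Y : Fin k → Ω → ℝ}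
    (hY : ∀ j, IsLevyIntegral P (twoSided L₁ L₂) (g j) (Y j)) :
    IsInfinitelyDivisible (P.map fun ω j => Y j ω) := by
  have hlog := isLogCharFun_of_isLevyIntegral hL₁ hL₂ hcopy hK h0 hψ hg hY
  choose hYm G hG hGY using hY
  have hL := aestronglyMeasurable_twoSided hL₁ hL₂
  have hYa : AEMeasurable (fun ω j => Y j ω) P :=
    aemeasurable_pi_iff.2 fun j => (hYm j).1.aemeasurable
  have : IsProbabilityMeasure (P.map fun ω j => Y j ω) := Measure.isProbabilityMeasure_map hYa
  have hcont : ∀ θ : Fin k → ℝ,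
      Measurable fun x : Fin k → ℝ => Complex.exp (Complex.I * ((∑ j, θ j * x j : ℝ) : ℂ)) :=
    fun θ => by fun_prop
  refine isInfinitelyDivisible_of_charFun (Ψ := fun θ => ∫ u, ψ (∑ j, θ j * g j u))
    (fun θ => ?_) fun n hn => ?_
  · rw [integral_map hYa (hcont θ).aestronglyMeasurable]
    exact hlog.charFun_eq θ
  · have hn' : (0 : ℝ) < n := by exact_mod_cast hn
    set H : ℕ → Fin k → StepFunction := fun m j => (G j m).rescale n hn' with hH
    have hHa : ∀ m, AEMeasurable (fun ω j => (H m j).integral (twoSided L₁ L₂) ω) P := fun m =>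
      aemeasurable_pi_iff.2 fun j => ((H m j).aestronglyMeasurable_integral hL).aemeasurable
    have : ∀ m, IsProbabilityMeasure
        (P.map fun ω j => (H m j).integral (twoSided L₁ L₂) ω) :=
      fun m => Measure.isProbabilityMeasure_map (hHa m)
    refine exists_law_of_tendsto_integral_exp
      (fun m => P.map fun ω j => (H m j).integral (twoSided L₁ L₂) ω)
      (F := fun θ => Complex.exp ((n : ℂ)⁻¹ * ∫ u, ψ (∑ j, θ j * g j u)))
      (Complex.continuous_exp.comp (hlog.continuous.const_mul _)) fun θ => ?_
    have e : ∀ m, ∫ x, Complex.exp (Complex.I * ((∑ j, θ j * x j : ℝ) : ℂ))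
        ∂(P.map fun ω j => (H m j).integral (twoSided L₁ L₂) ω) =
        Complex.exp ((n : ℂ)⁻¹ * ∫ u, ψ (∑ j, θ j * (G j m).eval u)) := by
      intro m
      rw [integral_map (hHa m) (hcont θ).aestronglyMeasurable,
        charFun_stepFunction_integral hL₁ hL₂ hcopy hK h0 hψ]
      simp_rw [hH, StepFunction.eval_rescale]
      rw [Measure.integral_comp_mul_left (fun u => ψ (∑ j, θ j * (G j m).eval u)) (n : ℝ),
        abs_of_pos (inv_pos.2 hn'), Complex.real_smul]
      push_cast
      rfl
    simp_rw [e]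
    exact ((tendsto_integral_comp_stepFunction hK h0 (G := fun m j => G j m) hg hG θ).const_mul
      _).cexp

/-! ### Scaling of the kernel -/

/-- The set of `b` for which the kernel satisfies the scaling relation contains all powers of
`c`. -/
lemma kernel_scaling_zpow {f : ℝ → ℝ → ℝ} {c δ β : ℝ} (hc : 0 < c)
    (hf : ∀ t u : ℝ, f (c * t) (c ^ δ * u) = c ^ β * f t u) (m : ℤ) (t u : ℝ) :
    f (c ^ m * t) ((c ^ m) ^ δ * u) = (c ^ m) ^ β * f t u := by
  have hnat : ∀ (n : ℕ) (t u : ℝ), f (c ^ n * t) ((c ^ n) ^ δ * u) = (c ^ n) ^ β * f t u := by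
    intro n
    induction n with
    | zero => simp
    | succ n ih =>
      intro t u
      have hn : 0 ≤ c ^ n := by positivity
      rw [pow_succ', Real.mul_rpow hc.le hn, Real.mul_rpow hc.le hn, mul_assoc, mul_assoc, hf, ih,
        mul_assoc]
  rcases m with n | n
  · simpa using hnat n t u
  · have hp : 0 < c ^ (n + 1) := by positivity
    rw [zpow_negSucc]
    have h := hnat (n + 1) ((c ^ (n + 1))⁻¹ * t) (((c ^ (n + 1))⁻¹) ^ δ * u)
    rw [mul_inv_cancel_left₀ hp.ne', ← mul_assoc, ← Real.mul_rpow hp.le (inv_pos.2 hp).le,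
      mul_inv_cancel₀ hp.ne', Real.one_rpow, one_mul] at h
    rw [h, ← mul_assoc, ← Real.mul_rpow (inv_pos.2 hp).le hp.le, inv_mul_cancel₀ hp.ne',
      Real.one_rpow, one_mul]

end DilSemi

end

theorem proposition2p3 {Ω : Type*} [MeasurableSpace Ω] (P : Measure Ω) [IsProbabilityMeasure P]
    (L₁ L₂ : ℝ≥0 → Ω → ℝ) (γ : ℝ) (φ : Measure ℝ)
    (hL₁ : DilSemi.IsLevyProcess P L₁) (hL₂ : DilSemi.IsLevyProcess P L₂)
    (hcentered : DilSemi.IsCentered P L₁)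
    (htriplet : DilSemi.HasLevyTriplet P L₁ γ 0 φ)
    (hφ : IntegrableOn (fun x : ℝ => x ^ 2) {x : ℝ | 1 < |x|} φ)
    (hcopy : DilSemi.IsIndepCopy P L₁ L₂)
    (f : ℝ → ℝ → ℝ) (X : ℝ → Ω → ℝ)
    (hX : DilSemi.IsGeneralizedFractionalLevy P (DilSemi.twoSided L₁ L₂) f X)
    (c α δ : ℝ) (hc : 1 < c)
    (hf : ∀ t u : ℝ, f (c * t) (c ^ δ * u) = c ^ (α - δ / 2) * f t u) :
    DilSemi.IsDilativelySemistable P X c α δ := by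
  have hK := DilSemi.norm_compExponent_sub_le (htriplet.isLevyMeasure.integrable_sq hφ)
  have h0 := DilSemi.compExponent_zero φ
  have hψ : ∀ (t : ℝ≥0) (θ : ℝ), ∫ ω, Complex.exp (Complex.I * θ * L₁ t ω) ∂P =
      Complex.exp ((t : ℂ) * DilSemi.compExponent φ θ) := fun t θ => by
    rw [htriplet.charFun_eq, htriplet.levyExponent_eq_compExponent hcentered hφ]
  have hlog := fun (k : ℕ) (t : Fin k → ℝ) =>
    DilSemi.isLogCharFun_of_isLevyIntegral hL₁ hL₂ hcopy hK h0 hψ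
      (fun j => hX.memLp_kernel (t j)) (fun j => hX.isLevyIntegral (t j))
  refine ⟨hc, fun k t => DilSemi.isInfinitelyDivisible_of_isLevyIntegral hL₁ hL₂ hcopy hK h0 hψ
      (fun j => hX.memLp_kernel (t j)) (fun j => hX.isLevyIntegral (t j)), fun m => ?_⟩
  have hc0 : 0 < c := one_pos.trans hc
  have hb : 0 < c ^ m := zpow_pos hc0 m
  refine ⟨hb, fun k t => ⟨_, _, hlog k t, hlog k fun j => c ^ m * t j, fun θ => ?_⟩⟩
  have hbδ : 0 < (c ^ m) ^ δ := Real.rpow_pos_of_pos hb δ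
  -- substitute `u = b ^ δ * v` in the exponent at the times `b * t j`
  have hsub := Measure.integral_comp_mul_left
    (fun u => DilSemi.compExponent φ (∑ j, θ j * f (c ^ m * t j) u)) ((c ^ m) ^ δ)
  simp_rw [DilSemi.kernel_scaling_zpow hc0 hf m] at hsub
  rw [abs_of_pos (inv_pos.2 hbδ), Complex.real_smul] at hsub
  have e : ∀ u, ∑ j, (c ^ m) ^ (α - δ / 2) * θ j * f (t j) u =
      ∑ j, θ j * ((c ^ m) ^ (α - δ / 2) * f (t j) u) := fun u =>
    Finset.sum_congr rfl fun j _ => by ring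
  simp_rw [e]
  rw [hsub, ← mul_assoc, ← Complex.ofReal_mul, mul_inv_cancel₀ hbδ.ne', Complex.ofReal_one,
    one_mul]
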